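/- Let $\mathcal A$ be a complex unital Banach algebra. An element is quasinilpotent if its spectral radius is $0$. For $a\in\mathcal A$, the generalized Drazin inverse $a^d$ is the (unique, if it exists) element with $a^daa^d=a^d$, $aa^d=a^da$ and $a-a^2a^d$ quasinilpotent; $\mathcal A^d$ is the set of elements that have one, and $a^\pi=1-aa^d$ for $a\in\mathcal A^d$. Let $a,b\in\mathcal A^d$ satisfy $aba^\pi=a^\pi baa^\pi$ and $a^2a^db=aa^dba$, and suppose that at least one of the elements $a^\pi ba^\pi$, $a^\pi b$, $ba^\pi$, $aa^dbaa^d$, $aa^db$, $baa^d$ belongs to $\mathcal A^d$. Then $$a+b\in\mathcal A^d\iff 1+a^db\in\mathcal A^d\iff aa^d(1+a^db)\in\mathcal A^d\iff(1+a^db)aa^d\in\mathcal A^d\iff aa^d(1+a^db)aa^d\in\mathcal A^d.$$ In this case $c=aa^d(a+b)$ belongs to $\mathcal A^d$, $$c^d=a^d(1+a^db)^dbb^d+aa^d\sum_{n=0}^\infty b^\pi(-b)^n(a^d)^{n+1},$$ and $$\begin{aligned}(a+b)^d={}&c^d+\sum_{n=0}^\infty(b^d)^{n+1}(-a)^na^\pi-\sum_{n=0}^\infty(b^d)^{n+1}(-a)^na^\pi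 bc^d\\&+\sum_{n=0}^\infty\Big(\sum_{k=0}^\infty(b^d)^{k+1}(-a)^ka^\pi\Big)^{n+2}baa^dc^nc^\pi\\&+\sum_{n=0}^\infty\Big((a+b)^na^\pi b(c^d)^{n+2}-\sum_{k=0}^\infty(b^d)^{k+1}(-a)^ka^\pi(a+b)^{n+1}a^\pi b(c^d)^{n+2}\Big),\end{aligned}$$ where all the series (the inner series over $k$, and the outer series over $n$ with the displayed terms) converge unconditionally. -/

import Mathlib

open Filter Topology

section GeneralizedDrazin

variable {A : Type*} [NormedRing A] [NormedAlgebra ℂ A]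

/-- An element is quasinilpotent if its spectral radius is zero. -/
def IsQuasinilpotent (x : A) : Prop := spectralRadius ℂ x = 0

/-- `x` is a generalized Drazin (Koliha--Drazin) inverse of `a`:
`x a x = x`, `a x = x a`, and `a - a² x` is quasinilpotent. -/
structure IsGDrazinInverse (a x : A) : Prop where
  outer : x * a * x = x
  comm : a * x = x * a
  qnil : IsQuasinilpotent (a - a ^ 2 * x)

/-- The set of generalized Drazin invertible elements. -/
def IsGDrazinInvertible (a : A) : Prop := ∃ x, IsGDrazinInverse a x

open Classical in
/-- The generalized Drazin inverse (with value `0` if there is none). -/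
noncomputable def gDrazinInv (a : A) : A :=
  if h : IsGDrazinInvertible a then h.choose else 0

postfix:max "ᵈ" => gDrazinInv

/-- The spectral idempotent `1 - a aᵈ` of `a` at `0`. -/
noncomputable def specIdem (a : A) : A := 1 - a * aᵈ

theorem IsGDrazinInvertible.isGDrazinInverse {a : A} (h : IsGDrazinInvertible a) :
    IsGDrazinInverse a aᵈ := by
  unfold gDrazinInv
  rw [dif_pos h]
  exact h.choose_spec

theorem IsQuasinilpotent.tendsto_mul_norm_pow [CompleteSpace A] {r : A} (hr : IsQuasinilpotent r)
    (C : ℝ) (hC : 0 ≤ C) : Tendsto (fun n : ℕ => C ^ n * ‖r ^ n‖) atTop (𝓝 0) := by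
  have h := spectrum.pow_nnnorm_pow_one_div_tendsto_nhds_spectralRadius r
  rw [show spectralRadius ℂ r = 0 from hr] at h
  set e : ℝ := 1 / (2 * (C + 1)) with he
  have hepos : 0 < e := by positivity
  have h1 := h.eventually (gt_mem_nhds (ENNReal.ofReal_pos.mpr hepos))
  have h2 : ∀ᶠ n : ℕ in atTop, C ^ n * ‖r ^ n‖ ≤ (1 / 2 : ℝ) ^ n := by
    filter_upwards [h1, eventually_gt_atTop 0] with n hn hn0
    have hnR : (0 : ℝ) < n := by exact_mod_cast hn0
    have h3 : (‖r ^ n‖₊ : ENNReal) ≤ (ENNReal.ofReal e) ^ n := by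
      have := ENNReal.rpow_le_rpow hn.le hnR.le
      rwa [← ENNReal.rpow_mul, one_div_mul_cancel hnR.ne', ENNReal.rpow_one,
        ENNReal.rpow_natCast] at this
    have h4 : ‖r ^ n‖ ≤ e ^ n := by
      rw [← ENNReal.ofReal_pow hepos.le] at h3
      have h5 := ENNReal.toReal_mono ENNReal.ofReal_ne_top h3
      rw [ENNReal.toReal_ofReal (by positivity)] at h5
      simpa using h5
    calc C ^ n * ‖r ^ n‖ ≤ C ^ n * e ^ n := by gcongr
      _ = (C * e) ^ n := (mul_pow _ _ _).symm
      _ ≤ (1 / 2 : ℝ) ^ n := by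
        gcongr
        rw [he, mul_one_div, div_le_div_iff₀ (by positivity) (by norm_num)]
        linarith
  exact squeeze_zero' (Eventually.of_forall fun n => by positivity) h2
    (tendsto_pow_atTop_nhds_zero_of_lt_one (by norm_num) (by norm_num))

/-- The generalized Drazin inverse is unique. -/
theorem IsGDrazinInverse.unique [CompleteSpace A] {a x y : A}
    (hx : IsGDrazinInverse a x) (hy : IsGDrazinInverse a y) : x = y := by
  have key : ∀ z : A, ∀ u : A, IsQuasinilpotent u → ∀ w : A,
      (∀ n : ℕ, 0 < n → ‖w‖ ≤ ‖z ^ n‖ * ‖u ^ n‖) → w = 0 := by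
    intro z u hu w hw
    have ht := hu.tendsto_mul_norm_pow ‖z‖ (norm_nonneg z)
    have : ‖w‖ ≤ 0 := by
      refine ge_of_tendsto ht ?_
      filter_upwards [eventually_gt_atTop 0] with n hn
      exact (hw n hn).trans
        (mul_le_mul_of_nonneg_right (norm_pow_le' z hn) (norm_nonneg _))
    simpa using this
  have pw : ∀ z : A, IsGDrazinInverse a z → ∀ n : ℕ, 0 < n →
      z ^ n * a ^ n = a * z ∧ a ^ n * z ^ n = a * z ∧
      (a - a ^ 2 * z) ^ n = a ^ n * (1 - a * z) ∧
      (a - a ^ 2 * z) ^ n = (1 - a * z) * a ^ n := by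
    intro z hz n hn
    have hc : Commute a z := hz.comm
    have hid : IsIdempotentElem (a * z) := by
      change a * z * (a * z) = a * z
      rw [mul_assoc, ← mul_assoc z, hz.outer]
    have hid' : IsIdempotentElem (1 - a * z) := hid.one_sub
    have hca : Commute a (1 - a * z) :=
      (Commute.one_right a).sub_right ((Commute.refl a).mul_right hc)
    have h1 : a ^ n * z ^ n = a * z := by
      rw [← hc.mul_pow, hid.pow_eq hn.ne']
    have h2 : (a - a ^ 2 * z) ^ n = a ^ n * (1 - a * z) := by
      have : a - a ^ 2 * z = a * (1 - a * z) := by noncomm_ring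
      rw [this, hca.mul_pow, hid'.pow_eq hn.ne']
    exact ⟨by rw [← h1, (hc.pow_pow n n).eq], h1, h2, by rw [h2, (hca.pow_left n).eq]⟩
  have e1 : a * x * (1 - a * y) = 0 := by
    refine key x _ hy.qnil _ fun n hn => ?_
    rw [← (pw x hx n hn).1, mul_assoc, ← (pw y hy n hn).2.2.1]
    exact norm_mul_le _ _
  have e2 : (1 - a * x) * (a * y) = 0 := by
    refine key y _ hx.qnil _ fun n hn => ?_
    rw [← (pw y hy n hn).2.1, ← mul_assoc, ← (pw x hx n hn).2.2.2, mul_comm ‖y ^ n‖]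
    exact norm_mul_le _ _
  have e3 : a * x = a * y := by
    rw [mul_sub, mul_one, sub_eq_zero] at e1
    rw [sub_mul, one_mul, sub_eq_zero] at e2
    rw [e1, ← e2]
  calc x = x * (a * x) := by rw [← mul_assoc, hx.outer]
    _ = (x * a) * y := by rw [e3, mul_assoc]
    _ = a * y * y := by rw [← hx.comm, e3]
    _ = y := by rw [hy.comm, hy.outer]

theorem IsGDrazinInverse.gDrazinInv_eq [CompleteSpace A] {a x : A} (h : IsGDrazinInverse a x) :
    aᵈ = x :=
  (IsGDrazinInvertible.isGDrazinInverse ⟨x, h⟩).unique h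

end GeneralizedDrazin

/-!
Put `p = a * aᵈ`. The two compatibility conditions make `b`, hence also `a + b`, lower triangular
with respect to the idempotent `p`, and as soon as one corner of `b` is generalized Drazin
invertible, `bᵈ` is lower triangular too. The lower corner `(a + b) * (1 - p)` is the sum of
`b * (1 - p)` and the quasinilpotent `a * (1 - p)`, which commute, so its inverse is a Neumann-type
series. The upper corner `c` is the product of `a` and `p * (1 + aᵈ * b)`, which commute; it is
also the sum of the commuting elements `p * a` and `p * b`, which expands `cᵈ * (1 - b * bᵈ)` as a
series. Finally the inverse of a lower triangular element is assembled from the inverses of its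
corners: the remaining entry solves a Sylvester equation.
-/

section Triangular

variable {R : Type*} [Ring R] {p a b : R}

/-- `a` is lower triangular with respect to the idempotent `p`: in the Peirce decomposition
`[[p a p, p a (1 - p)], [(1 - p) a p, (1 - p) a (1 - p)]]` the upper right entry vanishes. Then the
diagonal entries are `p * a` and `a * (1 - p)`. -/
def IsLowerTriangular (p a : R) : Prop := p * a * (1 - p) = 0

theorem isLowerTriangular_iff_mul_mul_self : IsLowerTriangular p a ↔ p * a * p = p * a := by
  rw [IsLowerTriangular, mul_sub, mul_one, sub_eq_zero, eq_comm]

theorem isLowerTriangular_iff_one_sub_mul_mul :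
    IsLowerTriangular p a ↔ (1 - p) * (a * (1 - p)) = a * (1 - p) := by
  rw [IsLowerTriangular, sub_mul, one_mul, sub_eq_self, mul_assoc]

theorem mul_add_add_eq_left {x y z : R} (hp : IsIdempotentElem p) (hx : p * x = x)
    (hy : (1 - p) * y = y) (hz : (1 - p) * z = z) : p * (x + y + z) = x := by
  rw [← hy, ← hz, mul_add, mul_add, hx, ← mul_assoc, ← mul_assoc, hp.mul_one_sub_self, zero_mul,
    zero_mul, add_zero, add_zero]

theorem add_add_mul_one_sub_eq {x y z : R} (hp : IsIdempotentElem p) (hx : x * p = x)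
    (hy : y * (1 - p) = y) (hz : z * p = z) : (x + y + z) * (1 - p) = y := by
  rw [← hx, ← hz, add_mul, add_mul, hy, mul_assoc, mul_assoc, hp.mul_one_sub_self, mul_zero,
    mul_zero, zero_add, add_zero]

namespace IsLowerTriangular

theorem of_commute (hp : IsIdempotentElem p) (h : Commute p a) : IsLowerTriangular p a := by
  rw [IsLowerTriangular, h.eq, mul_assoc, hp.mul_one_sub_self, mul_zero]

theorem mul_mul_self (h : IsLowerTriangular p a) : p * a * p = p * a :=
  isLowerTriangular_iff_mul_mul_self.1 h

theorem one_sub_mul_mul (h : IsLowerTriangular p a) : (1 - p) * (a * (1 - p)) = a * (1 - p) :=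
  isLowerTriangular_iff_one_sub_mul_mul.1 h

theorem add (ha : IsLowerTriangular p a) (hb : IsLowerTriangular p b) :
    IsLowerTriangular p (a + b) := by
  rw [IsLowerTriangular, mul_add, add_mul, ha, hb, add_zero]

theorem sub (ha : IsLowerTriangular p a) (hb : IsLowerTriangular p b) :
    IsLowerTriangular p (a - b) := by
  rw [IsLowerTriangular, mul_sub p, sub_mul, ha, hb, sub_zero]

theorem neg (h : IsLowerTriangular p a) : IsLowerTriangular p (-a) := by
  rw [IsLowerTriangular, mul_neg, neg_mul, h, neg_zero]

theorem upper_mul (h : IsLowerTriangular p a) : p * a * (p * b) = p * (a * b) := by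
  rw [← mul_assoc, h.mul_mul_self, mul_assoc]

theorem lower_mul (h : IsLowerTriangular p b) :
    a * (1 - p) * (b * (1 - p)) = a * b * (1 - p) := by
  rw [mul_assoc, h.one_sub_mul_mul, mul_assoc]

theorem mul (ha : IsLowerTriangular p a) (hb : IsLowerTriangular p b) :
    IsLowerTriangular p (a * b) := by
  rw [IsLowerTriangular, ← ha.upper_mul, mul_assoc, hb, mul_zero]

theorem upper_pow_mul (h : IsLowerTriangular p a) (n : ℕ) : (p * a) ^ n * p = p * a ^ n :=
  (SemiconjBy.pow_right (show SemiconjBy p a (p * a) from h.mul_mul_self.symm) n).eq.symm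

theorem one_sub_mul_lower_pow (h : IsLowerTriangular p a) (n : ℕ) :
    (1 - p) * (a * (1 - p)) ^ n = a ^ n * (1 - p) :=
  (SemiconjBy.pow_right (show SemiconjBy (1 - p) (a * (1 - p)) a from h.one_sub_mul_mul) n).eq

theorem upper_pow_succ (h : IsLowerTriangular p a) (n : ℕ) :
    (p * a) ^ (n + 1) = p * a ^ (n + 1) := by
  rw [pow_succ, ← mul_assoc, h.upper_pow_mul, mul_assoc, ← pow_succ]

theorem lower_pow_succ (h : IsLowerTriangular p a) (n : ℕ) :
    (a * (1 - p)) ^ (n + 1) = a ^ (n + 1) * (1 - p) := by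
  rw [pow_succ', mul_assoc, h.one_sub_mul_lower_pow, ← mul_assoc, ← pow_succ']

end IsLowerTriangular

end Triangular

section Quasinilpotent

variable {A : Type*} [NormedRing A] [NormedAlgebra ℂ A] {p r s x y z : A}

theorem isQuasinilpotent_iff_spectrum_subset : IsQuasinilpotent r ↔ spectrum ℂ r ⊆ {0} := by
  simp [IsQuasinilpotent, spectralRadius, Set.subset_def]

theorem isQuasinilpotent_iff_isUnit :
    IsQuasinilpotent r ↔ ∀ z : ℂ, IsUnit (1 - z • r) := by
  refine ⟨fun h z => spectrum.isUnit_one_sub_smul_of_lt_inv_radius ?_, fun h => ?_⟩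
  · rw [show spectralRadius ℂ r = 0 from h, ENNReal.inv_zero]
    exact ENNReal.coe_lt_top
  · refine isQuasinilpotent_iff_spectrum_subset.2 fun k hk => by_contra fun (hk0 : k ≠ 0) => hk ?_
    have hfactor : algebraMap ℂ A k - r = Units.mk0 k hk0 • (1 - k⁻¹ • r) := by
      simp [Units.smul_def, smul_sub, smul_smul, hk0, Algebra.algebraMap_eq_smul_one]
    rw [spectrum.mem_resolventSet_iff, hfactor]
    exact (h k⁻¹).smul _

namespace IsQuasinilpotent

theorem neg (h : IsQuasinilpotent r) : IsQuasinilpotent (-r) := by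
  rw [isQuasinilpotent_iff_isUnit] at h ⊢
  simpa only [smul_neg, ← neg_smul] using fun z => h (-z)

theorem mul_swap (h : IsQuasinilpotent (x * y)) : IsQuasinilpotent (y * x) := by
  rw [isQuasinilpotent_iff_spectrum_subset, ← Set.sdiff_eq_empty] at h ⊢
  rw [spectrum.nonzero_mul_comm, h]

theorem add_of_mul_eq_zero (hr : IsQuasinilpotent r) (hs : IsQuasinilpotent s) (h : r * s = 0) :
    IsQuasinilpotent (r + s) := by
  rw [isQuasinilpotent_iff_isUnit] at hr hs ⊢
  intro z
  have : 1 - z • (r + s) = (1 - z • r) * (1 - z • s) := by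
    simp only [mul_sub, sub_mul, smul_mul_smul_comm, h, smul_add, one_mul, mul_one, smul_zero]
    abel
  rw [this]
  exact (hr z).mul (hs z)

theorem of_isLowerTriangular (h : IsLowerTriangular p z) (hu : IsQuasinilpotent (p * z))
    (hl : IsQuasinilpotent (z * (1 - p))) : IsQuasinilpotent z := by
  have hz : z * p + z * (1 - p) = z := by rw [← mul_add, add_sub_cancel, mul_one]
  have hmul : z * p * (z * (1 - p)) = 0 := by
    rw [mul_assoc, ← mul_assoc p, h, mul_zero]
  rw [← hz]
  exact hu.mul_swap.add_of_mul_eq_zero hl hmul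

variable [CompleteSpace A]

theorem summable_mul_norm_pow (hr : IsQuasinilpotent r) {C : ℝ} (hC : 0 ≤ C) :
    Summable fun n : ℕ => C ^ n * ‖r ^ n‖ := by
  refine Summable.of_norm_bounded_eventually_nat summable_geometric_two ?_
  filter_upwards [(hr.tendsto_mul_norm_pow (2 * C) (by positivity)).eventually
    (gt_mem_nhds one_pos)] with n hn
  rw [Real.norm_of_nonneg (by positivity), one_div, inv_pow, ← one_div,
    le_div_iff₀ (by positivity)]
  calc C ^ n * ‖r ^ n‖ * 2 ^ n = (2 * C) ^ n * ‖r ^ n‖ := by rw [mul_pow]; ring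
    _ ≤ 1 := hn.le

theorem summable_of_norm_le (hr : IsQuasinilpotent r) {E : Type*} [NormedAddCommGroup E]
    [CompleteSpace E] {f : ℕ → E} {C K : ℝ} (hC : 0 ≤ C)
    (hf : ∀ n, 0 < n → ‖f n‖ ≤ K * (C ^ n * ‖r ^ n‖)) : Summable f := by
  refine Summable.of_norm_bounded_eventually_nat ((hr.summable_mul_norm_pow hC).mul_left K) ?_
  filter_upwards [eventually_gt_atTop 0] with n hn using hf n hn

theorem summable_pow_mul_pow (hr : IsQuasinilpotent r) (y z : A) :
    Summable fun n : ℕ => r ^ n * y * z ^ n := by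
  refine hr.summable_of_norm_le (norm_nonneg z) (K := ‖y‖) fun n hn => ?_
  calc ‖r ^ n * y * z ^ n‖ ≤ ‖r ^ n‖ * ‖y‖ * ‖z ^ n‖ := norm_mul₃_le
    _ ≤ ‖r ^ n‖ * ‖y‖ * ‖z‖ ^ n := by gcongr; exact norm_pow_le' z hn
    _ = ‖y‖ * (‖z‖ ^ n * ‖r ^ n‖) := by ring

theorem summable_pow_mul_pow' (hr : IsQuasinilpotent r) (z y : A) :
    Summable fun n : ℕ => z ^ n * y * r ^ n := by
  refine hr.summable_of_norm_le (norm_nonneg z) (K := ‖y‖) fun n hn => ?_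
  calc ‖z ^ n * y * r ^ n‖ ≤ ‖z ^ n‖ * ‖y‖ * ‖r ^ n‖ := norm_mul₃_le
    _ ≤ ‖z‖ ^ n * ‖y‖ * ‖r ^ n‖ := by gcongr; exact norm_pow_le' z hn
    _ = ‖y‖ * (‖z‖ ^ n * ‖r ^ n‖) := by ring

theorem of_norm_pow_le (hr : IsQuasinilpotent r) {C K : ℝ} (hC : 0 ≤ C)
    (h : ∀ n, 0 < n → ‖s ^ n‖ ≤ K * (C ^ n * ‖r ^ n‖)) : IsQuasinilpotent s := by
  refine isQuasinilpotent_iff_isUnit.2 fun z => ?_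
  have hs : Summable fun n : ℕ => (z • s) ^ n := by
    refine hr.summable_of_norm_le (C := ‖z‖ * C) (K := K) (by positivity) fun n hn => ?_
    calc ‖(z • s) ^ n‖ = ‖z‖ ^ n * ‖s ^ n‖ := by rw [smul_pow, norm_smul, norm_pow z]
      _ ≤ ‖z‖ ^ n * (K * (C ^ n * ‖r ^ n‖)) := by gcongr; exact h n hn
      _ = K * ((‖z‖ * C) ^ n * ‖r ^ n‖) := by rw [mul_pow]; ring
  exact isUnit_iff_exists.2 ⟨_, hs.one_sub_mul_tsum_pow, hs.tsum_pow_mul_one_sub⟩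

theorem mul_of_commute (hr : IsQuasinilpotent r) (h : Commute r s) :
    IsQuasinilpotent (r * s) := by
  refine hr.of_norm_pow_le (norm_nonneg s) (K := 1) fun n hn => ?_
  calc ‖(r * s) ^ n‖ ≤ ‖r ^ n‖ * ‖s ^ n‖ := by rw [h.mul_pow]; exact norm_mul_le _ _
    _ ≤ ‖r ^ n‖ * ‖s‖ ^ n := by gcongr; exact norm_pow_le' s hn
    _ = 1 * (‖s‖ ^ n * ‖r ^ n‖) := by ring

theorem add_of_commute (hr : IsQuasinilpotent r) (hs : IsQuasinilpotent s) (h : Commute r s) :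
    IsQuasinilpotent (r + s) := by
  refine isQuasinilpotent_iff_isUnit.2 fun z => ?_
  obtain ⟨u, hu⟩ := isQuasinilpotent_iff_isUnit.1 hr z
  have hsu : Commute s (u : A) := by
    rw [hu]
    exact (Commute.one_right s).sub_right (h.symm.smul_right z)
  have hfactor : 1 - z • (r + s) = (1 - z • (s * ↑u⁻¹)) * u := by
    rw [sub_mul, one_mul, smul_mul_assoc, Units.inv_mul_cancel_right, hu, smul_add, sub_sub]
  rw [hfactor]
  exact (isQuasinilpotent_iff_isUnit.1 (hs.mul_of_commute hsu.units_inv_right) z).mul u.isUnit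

theorem upper (hz : IsQuasinilpotent z) (h : IsLowerTriangular p z) :
    IsQuasinilpotent (p * z) := by
  refine hz.of_norm_pow_le zero_le_one (K := ‖p‖) fun n hn => ?_
  obtain ⟨m, rfl⟩ := Nat.exists_eq_succ_of_ne_zero hn.ne'
  rw [h.upper_pow_succ, one_pow, one_mul]
  exact norm_mul_le _ _

theorem lower (hz : IsQuasinilpotent z) (h : IsLowerTriangular p z) :
    IsQuasinilpotent (z * (1 - p)) := by
  refine hz.of_norm_pow_le zero_le_one (K := ‖1 - p‖) fun n hn => ?_
  obtain ⟨m, rfl⟩ := Nat.exists_eq_succ_of_ne_zero hn.ne'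
  rw [h.lower_pow_succ, one_pow, one_mul, mul_comm ‖1 - p‖]
  exact norm_mul_le _ _

end IsQuasinilpotent

end Quasinilpotent

namespace IsGDrazinInverse

variable {A : Type*} [NormedRing A] [NormedAlgebra ℂ A] {a b c p r t w x y z : A}

theorem isIdempotentElem (h : IsGDrazinInverse a x) : IsIdempotentElem (a * x) := by
  rw [IsIdempotentElem, mul_assoc, ← mul_assoc x, h.outer]

theorem mul_mul_self (h : IsGDrazinInverse a x) : x * (a * x) = x := by
  rw [← mul_assoc, h.outer]

theorem self_mul_mul (h : IsGDrazinInverse a x) : a * x * x = x := by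
  rw [h.comm, h.outer]

theorem mul_one_sub (h : IsGDrazinInverse a x) : x * (1 - a * x) = 0 := by
  rw [_root_.mul_one_sub, h.mul_mul_self, sub_self]

theorem commute (h : IsGDrazinInverse a x) : Commute a x :=
  h.comm

theorem commute_mul (h : IsGDrazinInverse a x) : Commute a (a * x) :=
  (Commute.refl a).mul_right h.commute

theorem commute_one_sub (h : IsGDrazinInverse a x) : Commute a (1 - a * x) :=
  (Commute.one_right a).sub_right h.commute_mul

theorem isLowerTriangular (h : IsGDrazinInverse a x) : IsLowerTriangular (a * x) a :=
  .of_commute h.isIdempotentElem h.commute_mul.symm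

theorem pow_mul_pow_succ (h : IsGDrazinInverse a x) (n : ℕ) :
    a ^ (n + 1) * x ^ (n + 1) = a * x := by
  rw [← h.commute.mul_pow, h.isIdempotentElem.pow_succ_eq]

theorem mul_mul_pow_succ (h : IsGDrazinInverse a x) (n : ℕ) :
    a * x * x ^ (n + 1) = x ^ (n + 1) := by
  rw [pow_succ', ← mul_assoc, h.self_mul_mul]

theorem pow_succ_mul_mul (h : IsGDrazinInverse a x) (n : ℕ) :
    x ^ (n + 1) * (a * x) = x ^ (n + 1) := by
  rw [pow_succ, mul_assoc, h.mul_mul_self]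

theorem mul_pow_add_two (h : IsGDrazinInverse a x) (n : ℕ) :
    a * x ^ (n + 2) = x ^ (n + 1) := by
  rw [pow_succ' x (n + 1), ← mul_assoc, h.mul_mul_pow_succ]

theorem pow_add_two_mul (h : IsGDrazinInverse a x) (n : ℕ) :
    x ^ (n + 2) * a = x ^ (n + 1) := by
  rw [pow_succ x (n + 1), mul_assoc, ← h.comm, h.pow_succ_mul_mul]

theorem isQuasinilpotent_mul_one_sub (h : IsGDrazinInverse a x) :
    IsQuasinilpotent (a * (1 - a * x)) := by
  simpa only [mul_sub, mul_one, ← mul_assoc, ← sq] using h.qnil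

theorem of_isQuasinilpotent_mul_one_sub (houter : x * (a * x) = x) (hcomm : a * x = x * a)
    (hqnil : IsQuasinilpotent (a * (1 - a * x))) : IsGDrazinInverse a x :=
  ⟨by rw [mul_assoc, houter], hcomm, by
    simpa only [mul_sub, mul_one, ← mul_assoc, ← sq] using hqnil⟩

theorem of_isIdempotentElem (h : IsIdempotentElem p) : IsGDrazinInverse p p := by
  refine of_isQuasinilpotent_mul_one_sub (by rw [h.eq, h.eq]) rfl ?_
  rw [h.eq, h.mul_one_sub_self]
  exact spectrum.spectralRadius_zero

theorem mul_eq_of_mul_eq (h : IsGDrazinInverse a x) (hp : p * a = a) : p * x = x := by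
  rw [← h.self_mul_mul, mul_assoc, ← mul_assoc, hp]

theorem eq_mul_of_eq_mul (h : IsGDrazinInverse a x) (hp : a * p = a) : x * p = x := by
  rw [← h.mul_mul_self, h.comm, mul_assoc, mul_assoc, hp]

theorem idempotent_mul_eq (hp : IsIdempotentElem p) (h : IsGDrazinInverse (p * a) x) :
    p * x = x :=
  h.mul_eq_of_mul_eq (by rw [← mul_assoc, hp.eq])

theorem mul_idempotent_eq (hp : IsIdempotentElem p) (h : IsGDrazinInverse (a * p) x) :
    x * p = x :=
  h.eq_mul_of_eq_mul (by rw [mul_assoc, hp.eq])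

theorem neg (h : IsGDrazinInverse a x) : IsGDrazinInverse (-a) (-x) := by
  refine of_isQuasinilpotent_mul_one_sub ?_ ?_ ?_
  · rw [neg_mul_neg, neg_mul, h.mul_mul_self]
  · rw [neg_mul_neg, neg_mul_neg, h.comm]
  · rw [neg_mul_neg, neg_mul]
    exact h.isQuasinilpotent_mul_one_sub.neg

theorem symm (h : IsGDrazinInverse a x) : IsGDrazinInverse x (a * (a * x)) := by
  have hxa : x * (a * (a * x)) = a * x := by
    rw [← mul_assoc, ← h.comm, h.isIdempotentElem.eq]
  have hax : a * (a * x) * x = a * x := by rw [mul_assoc, h.self_mul_mul]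
  refine of_isQuasinilpotent_mul_one_sub ?_ (hxa.trans hax.symm) ?_
  · rw [hxa, mul_assoc, h.isIdempotentElem.eq]
  · rw [hxa, h.mul_one_sub]
    exact spectrum.spectralRadius_zero

theorem mul_swap (h : IsGDrazinInverse (b * a) y) :
    IsGDrazinInverse (a * b) (a * y ^ 2 * b) := by
  have hl : a * b * (a * y ^ 2 * b) = a * y * b := by
    calc a * b * (a * y ^ 2 * b) = a * (b * a * y * y) * b := by noncomm_ring
      _ = a * y * b := by rw [h.self_mul_mul]
  have hr : a * y ^ 2 * b * (a * b) = a * y * b := by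
    calc a * y ^ 2 * b * (a * b) = a * (y * (y * (b * a))) * b := by noncomm_ring
      _ = a * y * b := by rw [← h.comm, h.mul_mul_self]
  refine of_isQuasinilpotent_mul_one_sub ?_ (hl.trans hr.symm) ?_
  · calc a * y ^ 2 * b * (a * b * (a * y ^ 2 * b)) = a * y * (y * (b * a * y)) * b := by
          rw [hl]; noncomm_ring
      _ = a * y ^ 2 * b := by rw [h.mul_mul_self]; noncomm_ring
  · have hfactor : a * b * (1 - a * b * (a * y ^ 2 * b)) = a * ((1 - b * a * y) * b) := by
      rw [hl]
      noncomm_ring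
    rw [hfactor]
    apply IsQuasinilpotent.mul_swap
    rw [mul_assoc, ← h.commute_one_sub.eq]
    exact h.isQuasinilpotent_mul_one_sub

theorem of_upper_of_lower (ha : IsLowerTriangular p a) (hx : IsLowerTriangular p x)
    (houter : x * (a * x) = x) (hcomm : a * x = x * a) (hu : IsGDrazinInverse (p * a) (p * x))
    (hl : IsGDrazinInverse (a * (1 - p)) (x * (1 - p))) : IsGDrazinInverse a x := by
  have hupper : p * (a * (1 - a * x)) = p * a * (1 - p * a * (p * x)) := by
    rw [ha.upper_mul, mul_sub a, mul_one, mul_sub p, mul_sub (p * a), mul_one, ha.upper_mul]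
  have hlower : a * (1 - a * x) * (1 - p) =
      a * (1 - p) * (1 - a * (1 - p) * (x * (1 - p))) := by
    rw [hx.lower_mul, mul_sub a 1, mul_one, sub_mul, mul_sub (a * (1 - p)) 1, mul_one,
      (ha.mul hx).lower_mul]
  refine of_isQuasinilpotent_mul_one_sub houter hcomm (.of_isLowerTriangular (p := p) ?_ ?_ ?_)
  · rw [_root_.mul_one_sub]
    exact ha.sub (ha.mul (ha.mul hx))
  · exact hupper ▸ hu.isQuasinilpotent_mul_one_sub
  · exact hlower ▸ hl.isQuasinilpotent_mul_one_sub

theorem of_entries (hp : IsIdempotentElem p) (hw : IsLowerTriangular p w)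
    (hx : IsGDrazinInverse (p * w) x) (hy : IsGDrazinInverse (w * (1 - p)) y)
    (hqz : (1 - p) * z = z) (hzp : z * p = z)
    (hsylvester : w * (1 - p) * z + (1 - p) * w * p * x = y * ((1 - p) * w * p) + z * (p * w))
    (houter : y * (w * (1 - p)) * z + y * ((1 - p) * w * p) * x + z * (p * w * x) = z) :
    IsGDrazinInverse w (x + y + z) := by
  have hpx : p * x = x := idempotent_mul_eq hp hx
  have hxp : x * p = x := hx.eq_mul_of_eq_mul hw.mul_mul_self
  have hqy : (1 - p) * y = y := hy.mul_eq_of_mul_eq hw.one_sub_mul_mul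
  have hyq : y * (1 - p) = y := mul_idempotent_eq hp.one_sub hy
  have hpX : p * (x + y + z) = x := mul_add_add_eq_left hp hpx hqy hqz
  have hXq : (x + y + z) * (1 - p) = y := add_add_mul_one_sub_eq hp hxp hyq hzp
  have hwX : w * (x + y + z) = p * w * x + w * (1 - p) * y +
      (w * (1 - p) * z + (1 - p) * w * p * x) := by
    rw [mul_assoc w _ y, hqy, mul_assoc w _ z, hqz, mul_assoc _ p, hpx]
    noncomm_ring
  have hXw : (x + y + z) * w = x * (p * w) + y * (w * (1 - p)) +
      (y * ((1 - p) * w * p) + z * (p * w)) := by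
    rw [← mul_assoc x p, hxp, ← mul_assoc z p, hzp, mul_assoc _ w p,
      ← mul_assoc y (1 - p), hyq]
    noncomm_ring
  have hcomm : w * (x + y + z) = (x + y + z) * w := by
    rw [hwX, hXw, hx.comm, hy.comm, hsylvester]
  refine of_upper_of_lower hw (by rw [IsLowerTriangular, hpX, _root_.mul_one_sub, hxp, sub_self])
    ?_ hcomm (by rwa [hpX]) (by rwa [hXq])
  have hδx : w * (1 - p) * x = 0 := by
    rw [← hpx, mul_assoc, ← mul_assoc _ p, hp.one_sub_mul_self, zero_mul, mul_zero]
  have hαX : p * w * (x + y + z) = p * w * x := by rw [mul_assoc, ← hw.upper_mul, hpX]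
  have hγX : (1 - p) * w * p * (x + y + z) = (1 - p) * w * p * x := by
    rw [mul_assoc _ p, hpX, mul_assoc _ p, hpx]
  calc (x + y + z) * (w * (x + y + z))
      = x * (p * w * x) + y * (w * (1 - p) * y) + (y * (w * (1 - p)) * z +
          y * ((1 - p) * w * p) * x + z * (p * w * x)) := by
        rw [← mul_assoc, hXw, add_mul, add_mul, add_mul, mul_assoc x, hαX, mul_assoc z, hαX,
          mul_assoc y _ (x + y + z), mul_assoc y _ (x + y + z), hγX, mul_add _ _ z,
          mul_add _ x, hδx]
        noncomm_ring
    _ = x + y + z := by rw [hx.mul_mul_self, hy.mul_mul_self, houter]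

variable [CompleteSpace A]

theorem summable_one_sub_mul_pow_mul (h : IsGDrazinInverse a x) (c z : A) :
    Summable fun n : ℕ => (1 - a * x) * a ^ n * c * z ^ n := by
  refine ((h.isQuasinilpotent_mul_one_sub.summable_pow_mul_pow c z).mul_left
    (1 - a * x)).congr fun n => ?_
  rw [← mul_assoc, ← mul_assoc, h.isLowerTriangular.one_sub_mul_lower_pow,
    (h.commute_one_sub.pow_left n).eq]

theorem summable_mul_pow_mul_one_sub (h : IsGDrazinInverse a x) (z c : A) :
    Summable fun n : ℕ => z ^ n * c * a ^ n * (1 - a * x) := by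
  refine (h.isQuasinilpotent_mul_one_sub.summable_pow_mul_pow' z (c * (1 - a * x))).congr
    fun n => ?_
  simp only [mul_assoc, h.isLowerTriangular.one_sub_mul_lower_pow]

-- Both products vanish: they are constant terms of a convergent series.
theorem one_sub_mul_mul_eq_zero (ha : IsGDrazinInverse a x) (hb : IsGDrazinInverse b y)
    (h : SemiconjBy t b a) : (1 - a * x) * t * (b * y) = 0 := by
  refine (summable_const_iff _).1 (((summable_nat_add_iff 1).2
    (ha.summable_one_sub_mul_pow_mul t y)).congr fun n => ?_)
  rw [mul_assoc _ _ t, ← (h.pow_right (n + 1)).eq, ← mul_assoc, mul_assoc, hb.pow_mul_pow_succ]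

theorem mul_mul_one_sub_eq_zero (ha : IsGDrazinInverse a x) (hb : IsGDrazinInverse b y)
    (h : SemiconjBy t b a) : a * x * t * (1 - b * y) = 0 := by
  refine (summable_const_iff _).1 (((summable_nat_add_iff 1).2
    (hb.summable_mul_pow_mul_one_sub x t)).congr fun n => ?_)
  rw [mul_assoc _ t, (h.pow_right (n + 1)).eq, ← mul_assoc,
    (ha.commute.symm.pow_pow _ _).eq, ha.pow_mul_pow_succ]

theorem semiconjBy (ha : IsGDrazinInverse a x) (hb : IsGDrazinInverse b y)
    (h : SemiconjBy t b a) : SemiconjBy t y x := by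
  have hproj : a * x * t = t * (b * y) := by
    have hl := ha.one_sub_mul_mul_eq_zero hb h
    have hr := ha.mul_mul_one_sub_eq_zero hb h
    rw [one_sub_mul, sub_mul, sub_eq_zero] at hl
    rw [_root_.mul_one_sub, sub_eq_zero] at hr
    rw [hr, ← hl]
  calc t * y = t * (b * y) * y := by rw [mul_assoc, hb.self_mul_mul]
    _ = x * (a * t) * y := by rw [← hproj, ha.comm, mul_assoc x]
    _ = x * (t * (b * y)) := by rw [← h.eq]; simp only [mul_assoc]
    _ = x * t := by rw [← hproj, ← mul_assoc, ha.mul_mul_self]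

theorem commute_of_commute (ha : IsGDrazinInverse a x) (h : Commute a t) : Commute x t :=
  (ha.semiconjBy ha h.symm).symm

theorem mul_of_commute (ha : IsGDrazinInverse a x) (hb : IsGDrazinInverse b y)
    (h : Commute a b) : IsGDrazinInverse (a * b) (x * y) := by
  have hax := ha.commute
  have hby := hb.commute
  have hxb : Commute x b := ha.commute_of_commute h
  have hya : Commute y a := hb.commute_of_commute h.symm
  have hyx : Commute y x := hb.commute_of_commute hxb.symm
  have hmul : a * b * (x * y) = a * x * (b * y) := hxb.symm.mul_mul_mul_comm a y
  refine of_isQuasinilpotent_mul_one_sub ?_ ?_ ?_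
  · rw [hmul, (hya.mul_right hyx).mul_mul_mul_comm, ha.mul_mul_self, hb.mul_mul_self]
  · exact ((hax.mul_left hxb.symm).mul_right (hya.symm.mul_left hby)).eq
  · have hbax : Commute b (a * x) := by simp [h.symm, hxb.symm]
    have hsplit : a * b * (1 - a * b * (x * y)) =
        a * (1 - a * x) * b + a * (a * x) * (b * (1 - b * y)) := by
      rw [mul_sub (a * b), hmul, hbax.mul_mul_mul_comm]
      noncomm_ring
    have hright : Commute (b * (1 - b * y)) (a * (a * x)) := by
      simp (maxDischargeDepth := 5) [h.symm, hxb.symm, hya, hyx]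
    rw [hsplit, ← hright.eq]
    refine (ha.isQuasinilpotent_mul_one_sub.mul_of_commute ?_).add_of_commute
      (hb.isQuasinilpotent_mul_one_sub.mul_of_commute hright) ?_ <;>
    simp (maxDischargeDepth := 9) [h, h.symm, hxb, hxb.symm, hax, hax.symm, hya.symm, hyx.symm, hby]

theorem summable_pow_succ_mul_neg_pow (hr : IsQuasinilpotent r) (y : A) :
    Summable fun n : ℕ => y ^ (n + 1) * (-r) ^ n := by
  simpa only [← pow_succ] using hr.neg.summable_pow_mul_pow' y y

theorem add_of_commute (hb : IsGDrazinInverse b y) (hr : IsQuasinilpotent r)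
    (h : Commute r b) : IsGDrazinInverse (r + b) (∑' n : ℕ, y ^ (n + 1) * (-r) ^ n) := by
  have hs := summable_pow_succ_mul_neg_pow hr y
  have hry : Commute r y := (hb.commute_of_commute h.symm).symm
  set Z := ∑' n : ℕ, y ^ (n + 1) * (-r) ^ n with hZ
  have hrZ : Commute r Z := .tsum_right _ fun n =>
    (hry.pow_right _).mul_right ((Commute.refl r).neg_right.pow_right n)
  have hbZ : Commute b Z := .tsum_right _ fun n =>
    (hb.commute.pow_right _).mul_right (h.symm.neg_right.pow_right n)
  have hbyZ : b * y * Z = Z := by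
    rw [hZ, ← hs.tsum_mul_left]
    exact tsum_congr fun n => by rw [← mul_assoc, hb.mul_mul_pow_succ]
  have htelescope : b * Z = b * y - Z * r := by
    have hstep (n : ℕ) : b * (y ^ (n + 2) * (-r) ^ (n + 1)) = -(y ^ (n + 1) * (-r) ^ n * r) := by
      rw [← mul_assoc, hb.mul_pow_add_two, pow_succ (-r), mul_neg, mul_neg, mul_assoc]
    rw [hZ, ← hs.tsum_mul_left, (hs.mul_left b).tsum_eq_zero_add, tsum_congr hstep, tsum_neg,
      hs.tsum_mul_right, zero_add, pow_one, pow_zero, mul_one, sub_eq_add_neg]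
  have hmul : (r + b) * Z = b * y := by rw [add_mul, htelescope, hrZ.eq, add_sub_cancel]
  have hrq : Commute r (1 - b * y) := (Commute.one_right r).sub_right (h.mul_right hry)
  refine of_isQuasinilpotent_mul_one_sub ?_ (hrZ.add_left hbZ).eq ?_
  · have hZby : Commute Z (b * y) := by
      rw [← hmul]
      exact (hrZ.symm.add_right hbZ.symm).mul_right (.refl Z)
    rw [hmul, hZby.eq, hbyZ]
  · rw [hmul, add_mul]
    exact (hr.mul_of_commute hrq).add_of_commute hb.isQuasinilpotent_mul_one_sub
      ((h.mul_right hrq).mul_left (hb.commute_one_sub.symm.mul_right (.refl _)))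

end IsGDrazinInverse

section Coupling

variable {A : Type*} [NormedRing A] [NormedAlgebra ℂ A] {a c d p w x y : A}

/-- The lower left entry of the generalized Drazin inverse of the block matrix `[[a, 0], [c, d]]`
when `x` and `y` are the generalized Drazin inverses of `a` and `d`, as in the formula of
Hartwig–Shoaf and Meyer–Rose. -/
noncomputable def gDrazinCoupling (a x c d y : A) : A :=
  (∑' n : ℕ, (1 - d * y) * d ^ n * c * x ^ (n + 2)) +
    (∑' n : ℕ, y ^ (n + 2) * c * a ^ n * (1 - a * x)) - y * c * x

namespace IsGDrazinInverse

variable [CompleteSpace A]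

theorem summable_coupling_left (hd : IsGDrazinInverse d y) (c x : A) (k : ℕ) :
    Summable fun n : ℕ => (1 - d * y) * d ^ n * c * x ^ (n + k) := by
  simpa only [pow_add, ← mul_assoc] using (hd.summable_one_sub_mul_pow_mul c x).mul_right (x ^ k)

theorem summable_coupling_right (ha : IsGDrazinInverse a x) (y c : A) (k : ℕ) :
    Summable fun n : ℕ => y ^ (n + k) * c * a ^ n * (1 - a * x) := by
  simpa only [pow_add, mul_assoc] using ha.summable_mul_pow_mul_one_sub y (y ^ k * c)

theorem coupling_left_sylvester (ha : IsGDrazinInverse a x) (hd : IsGDrazinInverse d y) (c : A) :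
    d * (∑' n : ℕ, (1 - d * y) * d ^ n * c * x ^ (n + 2)) -
      (∑' n : ℕ, (1 - d * y) * d ^ n * c * x ^ (n + 2)) * a = -((1 - d * y) * c * x) := by
  have hs := hd.summable_coupling_left c x 2
  have hleft (n : ℕ) : d * ((1 - d * y) * d ^ n * c * x ^ (n + 2)) =
      (1 - d * y) * d ^ (n + 1) * c * x ^ (n + 1 + 1) := by
    simp only [pow_succ' d, ← mul_assoc, hd.commute_one_sub.eq]
  have hright (n : ℕ) : (1 - d * y) * d ^ n * c * x ^ (n + 2) * a =
      (1 - d * y) * d ^ n * c * x ^ (n + 1) := by rw [mul_assoc, ha.pow_add_two_mul]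
  rw [← hs.tsum_mul_left, ← hs.tsum_mul_right, tsum_congr hleft, tsum_congr hright,
    (hd.summable_coupling_left c x 1).tsum_eq_zero_add]
  simp

theorem coupling_right_sylvester (ha : IsGDrazinInverse a x) (hd : IsGDrazinInverse d y) (c : A) :
    d * (∑' n : ℕ, y ^ (n + 2) * c * a ^ n * (1 - a * x)) -
      (∑' n : ℕ, y ^ (n + 2) * c * a ^ n * (1 - a * x)) * a = y * c * (1 - a * x) := by
  have hs := ha.summable_coupling_right y c 2
  have hleft (n : ℕ) : d * (y ^ (n + 2) * c * a ^ n * (1 - a * x)) =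
      y ^ (n + 1) * c * a ^ n * (1 - a * x) := by
    simp only [← mul_assoc, hd.mul_pow_add_two]
  have hright (n : ℕ) : y ^ (n + 2) * c * a ^ n * (1 - a * x) * a =
      y ^ (n + 1 + 1) * c * a ^ (n + 1) * (1 - a * x) := by
    simp only [pow_succ a, mul_assoc, ha.commute_one_sub.eq]
  rw [← hs.tsum_mul_left, ← hs.tsum_mul_right, tsum_congr hleft, tsum_congr hright,
    (ha.summable_coupling_right y c 1).tsum_eq_zero_add]
  simp

-- The two sides are the lower left entries of `W * X` and `X * W` for `W = [[a, 0], [c, d]]` and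
-- `X = [[x, 0], [z, y]]` with `z` the coupling; `coupling_outer` is that of `X * W * X = X`.
theorem coupling_sylvester (ha : IsGDrazinInverse a x) (hd : IsGDrazinInverse d y) (c : A) :
    d * gDrazinCoupling a x c d y + c * x = y * c + gDrazinCoupling a x c d y * a := by
  have hl := ha.coupling_left_sylvester hd c
  have hr := ha.coupling_right_sylvester hd c
  rw [sub_eq_iff_eq_add] at hl hr
  rw [gDrazinCoupling, mul_sub, mul_add, hl, hr, ha.comm]
  noncomm_ring

theorem coupling_outer (ha : IsGDrazinInverse a x) (hd : IsGDrazinInverse d y) (c : A) :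
    y * d * gDrazinCoupling a x c d y + y * c * x + gDrazinCoupling a x c d y * (a * x) =
      gDrazinCoupling a x c d y := by
  have hs := hd.summable_coupling_left c x 2
  have ht := ha.summable_coupling_right y c 2
  have hdl (n : ℕ) : y * d * ((1 - d * y) * d ^ n * c * x ^ (n + 2)) = 0 := by
    simp only [← hd.comm, ← mul_assoc, hd.isIdempotentElem.mul_one_sub_self, zero_mul]
  have hdr (n : ℕ) : y * d * (y ^ (n + 2) * c * a ^ n * (1 - a * x)) =
      y ^ (n + 2) * c * a ^ n * (1 - a * x) := by
    simp only [← hd.comm, ← mul_assoc, hd.mul_mul_pow_succ]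
  have hal (n : ℕ) : (1 - d * y) * d ^ n * c * x ^ (n + 2) * (a * x) =
      (1 - d * y) * d ^ n * c * x ^ (n + 2) := by rw [mul_assoc, ha.pow_succ_mul_mul]
  have har (n : ℕ) : y ^ (n + 2) * c * a ^ n * (1 - a * x) * (a * x) = 0 := by
    rw [mul_assoc, ha.isIdempotentElem.one_sub_mul_self, mul_zero]
  have hdm : y * d * (y * c * x) = y * c * x := by simp only [← mul_assoc, hd.outer]
  have ham : y * c * x * (a * x) = y * c * x := by rw [mul_assoc, ha.mul_mul_self]
  rw [gDrazinCoupling, mul_sub, mul_add, sub_mul, add_mul, ← hs.tsum_mul_left, ← ht.tsum_mul_left,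
    ← hs.tsum_mul_right, ← ht.tsum_mul_right, tsum_congr hdl, tsum_congr hdr, tsum_congr hal,
    tsum_congr har, hdm, ham, tsum_zero]
  abel

theorem mul_coupling {e : A} (ha : IsGDrazinInverse a x) (hd : IsGDrazinInverse d y)
    (h : Commute d e) (c : A) :
    e * gDrazinCoupling a x c d y = gDrazinCoupling a x (e * c) d y := by
  have hy : Commute e y := (hd.commute_of_commute h).symm
  have hdy : Commute e (1 - d * y) := (Commute.one_right e).sub_right (h.symm.mul_right hy)
  rw [gDrazinCoupling, gDrazinCoupling, mul_sub, mul_add,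
    ← (hd.summable_coupling_left c x 2).tsum_mul_left,
    ← (ha.summable_coupling_right y c 2).tsum_mul_left]
  simp only [← mul_assoc, hy.eq, (hy.pow_right _).eq, hdy.eq]
  simp only [mul_assoc _ e, (h.symm.pow_right _).eq]
  simp only [mul_assoc]

theorem coupling_mul {e : A} (ha : IsGDrazinInverse a x) (hd : IsGDrazinInverse d y)
    (h : Commute a e) (c : A) :
    gDrazinCoupling a x c d y * e = gDrazinCoupling a x (c * e) d y := by
  have hx : Commute x e := ha.commute_of_commute h
  have hax : Commute (1 - a * x) e := (Commute.one_left e).sub_left (h.mul_left hx)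
  rw [gDrazinCoupling, gDrazinCoupling, sub_mul, add_mul,
    ← (hd.summable_coupling_left c x 2).tsum_mul_right,
    ← (ha.summable_coupling_right y c 2).tsum_mul_right]
  simp only [mul_assoc, hx.eq, (hx.pow_left _).eq, hax.eq]
  simp only [← mul_assoc e, ← (h.pow_left _).eq]
  simp only [mul_assoc]

theorem coupling_corners (hp : IsIdempotentElem p) (hw : IsLowerTriangular p w)
    (hx : IsGDrazinInverse (p * w) x) (hy : IsGDrazinInverse (w * (1 - p)) y) :
    (1 - p) * gDrazinCoupling (p * w) x ((1 - p) * w * p) (w * (1 - p)) y =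
        gDrazinCoupling (p * w) x ((1 - p) * w * p) (w * (1 - p)) y ∧
      gDrazinCoupling (p * w) x ((1 - p) * w * p) (w * (1 - p)) y * p =
        gDrazinCoupling (p * w) x ((1 - p) * w * p) (w * (1 - p)) y := by
  have hupper : Commute (p * w) p := by
    rw [Commute, SemiconjBy, hw.mul_mul_self, ← mul_assoc, hp.eq]
  have hlower : Commute (w * (1 - p)) (1 - p) := by
    rw [Commute, SemiconjBy, hw.one_sub_mul_mul, mul_assoc, hp.one_sub.eq]
  constructor
  · rw [hx.mul_coupling hy hlower, ← mul_assoc, ← mul_assoc, hp.one_sub.eq]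
  · rw [hx.coupling_mul hy hupper, mul_assoc, hp.eq]

theorem of_corners (hp : IsIdempotentElem p) (hw : IsLowerTriangular p w)
    (hx : IsGDrazinInverse (p * w) x) (hy : IsGDrazinInverse (w * (1 - p)) y) :
    IsGDrazinInverse w
      (x + y + gDrazinCoupling (p * w) x ((1 - p) * w * p) (w * (1 - p)) y) :=
  have ⟨hqz, hzp⟩ := coupling_corners hp hw hx hy
  of_entries hp hw hx hy hqz hzp (hx.coupling_sylvester hy _) (hx.coupling_outer hy _)

end IsGDrazinInverse

end Coupling

section Corners

variable {A : Type*} [NormedRing A] [NormedAlgebra ℂ A] {a b e p w x y : A}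

theorem isGDrazinInvertible_mul_comm :
    IsGDrazinInvertible (a * b) ↔ IsGDrazinInvertible (b * a) :=
  ⟨fun ⟨_, h⟩ => ⟨_, h.mul_swap⟩, fun ⟨_, h⟩ => ⟨_, h.mul_swap⟩⟩

theorem isGDrazinInvertible_mul_mul_self_iff (he : IsIdempotentElem e) :
    IsGDrazinInvertible (e * a * e) ↔ IsGDrazinInvertible (e * a) := by
  rw [isGDrazinInvertible_mul_comm, ← mul_assoc, he.eq]

variable [CompleteSpace A]

namespace IsGDrazinInverse

theorem mul_isIdempotentElem (ha : IsGDrazinInverse a x) (he : IsIdempotentElem e)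
    (h : Commute a e) : IsGDrazinInverse (a * e) (x * e) :=
  ha.mul_of_commute (.of_isIdempotentElem he) h

theorem upper (h : IsGDrazinInverse a x) (ha : IsLowerTriangular p a)
    (hx : IsLowerTriangular p x) : IsGDrazinInverse (p * a) (p * x) := by
  refine of_isQuasinilpotent_mul_one_sub ?_ ?_ ?_
  · rw [ha.upper_mul, hx.upper_mul, h.mul_mul_self]
  · rw [ha.upper_mul, hx.upper_mul, h.comm]
  · have hupper : p * a * (1 - p * a * (p * x)) = p * (a * (1 - a * x)) := by
      rw [ha.upper_mul, mul_sub, ha.upper_mul]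
      noncomm_ring
    rw [hupper]
    refine h.isQuasinilpotent_mul_one_sub.upper ?_
    rw [_root_.mul_one_sub]
    exact ha.sub (ha.mul (ha.mul hx))

theorem lower (h : IsGDrazinInverse a x) (ha : IsLowerTriangular p a)
    (hx : IsLowerTriangular p x) : IsGDrazinInverse (a * (1 - p)) (x * (1 - p)) := by
  refine of_isQuasinilpotent_mul_one_sub ?_ ?_ ?_
  · rw [hx.lower_mul, (ha.mul hx).lower_mul, h.mul_mul_self]
  · rw [hx.lower_mul, ha.lower_mul, h.comm]
  · have hlower : a * (1 - p) * (1 - a * (1 - p) * (x * (1 - p))) =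
        a * (1 - a * x) * (1 - p) := by
      rw [hx.lower_mul, mul_sub (a * (1 - p)), (ha.mul hx).lower_mul]
      noncomm_ring
    rw [hlower]
    refine h.isQuasinilpotent_mul_one_sub.lower ?_
    rw [_root_.mul_one_sub]
    exact ha.sub (ha.mul (ha.mul hx))

theorem isLowerTriangular_of_upper (h : IsGDrazinInverse a x) (hp : IsIdempotentElem p)
    (ha : IsLowerTriangular p a) (hy : IsGDrazinInverse (p * a) y) : IsLowerTriangular p x := by
  have hpx : p * x = y * p := hy.semiconjBy h ha.mul_mul_self.symm
  rw [isLowerTriangular_iff_mul_mul_self, hpx, mul_assoc, hp.eq]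

theorem isLowerTriangular_of_lower (h : IsGDrazinInverse a x) (hp : IsIdempotentElem p)
    (ha : IsLowerTriangular p a) (hy : IsGDrazinInverse (a * (1 - p)) y) :
    IsLowerTriangular p x := by
  have hqy : (1 - p) * y = x * (1 - p) := h.semiconjBy hy ha.one_sub_mul_mul
  rw [isLowerTriangular_iff_one_sub_mul_mul, ← hqy, ← mul_assoc, hp.one_sub.eq]

end IsGDrazinInverse

theorem IsLowerTriangular.isGDrazinInvertible_iff_upper (hw : IsLowerTriangular p w)
    (hp : IsIdempotentElem p) (hl : IsGDrazinInvertible (w * (1 - p))) :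
    IsGDrazinInvertible w ↔ IsGDrazinInvertible (p * w) := by
  obtain ⟨y, hy⟩ := hl
  exact ⟨fun ⟨_, hx⟩ => ⟨_, hx.upper hw (hx.isLowerTriangular_of_lower hp hw hy)⟩,
    fun ⟨_, hx⟩ => ⟨_, .of_corners hp hw hx hy⟩⟩

theorem IsGDrazinInverse.isLowerTriangular_of_corner (hb : IsGDrazinInverse b y)
    (hp : IsIdempotentElem p) (hbp : IsLowerTriangular p b)
    (h : IsGDrazinInvertible ((1 - p) * b * (1 - p)) ∨ IsGDrazinInvertible ((1 - p) * b) ∨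
      IsGDrazinInvertible (b * (1 - p)) ∨ IsGDrazinInvertible (p * b * p) ∨
      IsGDrazinInvertible (p * b) ∨ IsGDrazinInvertible (b * p)) : IsLowerTriangular p y := by
  rw [isGDrazinInvertible_mul_mul_self_iff hp.one_sub, isGDrazinInvertible_mul_mul_self_iff hp,
    isGDrazinInvertible_mul_comm (a := 1 - p), isGDrazinInvertible_mul_comm (a := b) (b := p),
    or_self, or_self, or_self_left, or_self_left] at h
  rcases h with ⟨_, hl⟩ | ⟨_, hu⟩
  · exact hb.isLowerTriangular_of_lower hp hbp hl
  · exact hb.isLowerTriangular_of_upper hp hbp hu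

end Corners

section Compatible

variable {A : Type*} [NormedRing A] [NormedAlgebra ℂ A] {a b x y : A}

namespace IsGDrazinInverse

theorem isLowerTriangular_of_compatible (ha : IsGDrazinInverse a x)
    (h : a * b * (1 - a * x) = (1 - a * x) * b * a * (1 - a * x)) :
    IsLowerTriangular (a * x) b := by
  calc a * x * b * (1 - a * x) = x * (a * b * (1 - a * x)) := by
        rw [ha.comm]
        simp only [mul_assoc]
    _ = x * (1 - a * x) * (b * a * (1 - a * x)) := by
        rw [h]
        simp only [mul_assoc]
    _ = 0 := by rw [ha.mul_one_sub, zero_mul]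

theorem commute_of_compatible (ha : IsGDrazinInverse a x)
    (h : a * b * (1 - a * x) = (1 - a * x) * b * a * (1 - a * x)) :
    Commute (a * (1 - a * x)) (b * (1 - a * x)) := by
  have hb := ha.isLowerTriangular_of_compatible h
  have ha' := ha.isLowerTriangular
  rw [Commute, SemiconjBy, hb.lower_mul, ha'.lower_mul, h, mul_assoc _ a,
    ← ha'.one_sub_mul_mul, ← mul_assoc, mul_assoc _ b, hb.one_sub_mul_mul, ha'.lower_mul]

theorem commute_one_add_of_commute (ha : IsGDrazinInverse a x) (h : Commute a (a * x * b)) :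
    Commute a (1 + x * b) := by
  have hxb : x * (a * x * b) = x * b := by rw [← mul_assoc, ha.mul_mul_self]
  refine (Commute.one_right a).add_right ?_
  rw [← hxb]
  exact ha.commute.mul_right h

theorem mul_mul_add_eq (ha : IsGDrazinInverse a x) :
    a * x * (a + b) = a * (a * x * (1 + x * b)) := by
  have hxb : a * x * (x * b) = x * b := by rw [← mul_assoc, ha.self_mul_mul]
  rw [mul_add, mul_add, mul_one, hxb, mul_add, ← mul_assoc a x b, ha.commute_mul.eq]

theorem mul_mul_mul_add_eq (ha : IsGDrazinInverse a x) :
    x * (a * x * (a + b)) = a * x * (1 + x * b) := by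
  rw [ha.mul_mul_add_eq, ← mul_assoc, ← ha.comm, ← mul_assoc, ha.isIdempotentElem.eq]

theorem one_add_mul_one_sub (ha : IsGDrazinInverse a x) (hb : IsLowerTriangular (a * x) b) :
    (1 + x * b) * (1 - a * x) = 1 - a * x := by
  have hxb : x * b * (1 - a * x) = x * (a * x * b * (1 - a * x)) := by
    rw [← mul_assoc, ← mul_assoc, ha.mul_mul_self]
  rw [add_mul, one_mul, hxb, hb, mul_zero, add_zero]

variable [CompleteSpace A]

theorem commute_mul_of_commute (ha : IsGDrazinInverse a x) (h : Commute a b) :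
    Commute (a * x) b :=
  h.mul_left (ha.commute_of_commute h)

theorem summable_mul_neg_pow_mul_one_sub (ha : IsGDrazinInverse a x) (y : A) :
    Summable fun n : ℕ => y ^ (n + 1) * (-a) ^ n * (1 - a * x) := by
  simpa only [neg_mul_neg, ← pow_succ] using ha.neg.summable_mul_pow_mul_one_sub y y

theorem lower_add (ha : IsGDrazinInverse a x) (hb : IsGDrazinInverse b y)
    (hbp : IsLowerTriangular (a * x) b) (hyp : IsLowerTriangular (a * x) y)
    (h : Commute (a * (1 - a * x)) (b * (1 - a * x))) :
    IsGDrazinInverse ((a + b) * (1 - a * x))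
      (∑' n : ℕ, y ^ (n + 1) * (-a) ^ n * (1 - a * x)) := by
  have hterm (n : ℕ) : y ^ (n + 1) * (-a) ^ n * (1 - a * x) =
      (y * (1 - a * x)) ^ (n + 1) * (-(a * (1 - a * x))) ^ n := by
    rw [hyp.lower_pow_succ, ← neg_mul, mul_assoc, mul_assoc,
      ha.isLowerTriangular.neg.one_sub_mul_lower_pow]
  rw [add_mul, tsum_congr hterm]
  exact (hb.lower hbp hyp).add_of_commute ha.isQuasinilpotent_mul_one_sub h

theorem tfae_add (ha : IsGDrazinInverse a x) (hbp : IsLowerTriangular (a * x) b)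
    (hcomm : Commute a (a * x * b)) (hl : IsGDrazinInvertible ((a + b) * (1 - a * x))) :
    List.TFAE [IsGDrazinInvertible (a + b), IsGDrazinInvertible (1 + x * b),
      IsGDrazinInvertible (a * x * (1 + x * b)), IsGDrazinInvertible ((1 + x * b) * a * x),
      IsGDrazinInvertible (a * x * (1 + x * b) * a * x)] := by
  have hp := ha.isIdempotentElem
  have hag := ha.commute_one_add_of_commute hcomm
  have hpg := ha.commute_mul_of_commute hag
  have hright : (1 + x * b) * a * x = a * x * (1 + x * b) := by rw [mul_assoc, hpg.eq]
  have hboth : a * x * (1 + x * b) * a * x = a * x * (1 + x * b) := by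
    rw [mul_assoc (a * x), mul_assoc (a * x), hright, ← mul_assoc, hp.eq]
  have hapg : Commute a (a * x * (1 + x * b)) := ha.commute_mul.mul_right hag
  tfae_have 1 ↔ 3 := by
    rw [(ha.isLowerTriangular.add hbp).isGDrazinInvertible_iff_upper hp hl]
    refine ⟨fun ⟨_, hc⟩ => ?_, fun ⟨_, hpg'⟩ => ?_⟩
    · rw [← ha.mul_mul_mul_add_eq]
      refine ⟨_, ha.symm.mul_of_commute hc ?_⟩
      rw [ha.mul_mul_add_eq]
      exact ha.commute_of_commute ((Commute.refl a).mul_right hapg)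
    · rw [ha.mul_mul_add_eq]
      exact ⟨_, ha.mul_of_commute hpg' hapg⟩
  tfae_have 2 ↔ 3 := by
    refine (IsLowerTriangular.of_commute hp hpg).isGDrazinInvertible_iff_upper hp ?_
    rw [ha.one_add_mul_one_sub hbp]
    exact ⟨_, .of_isIdempotentElem hp.one_sub⟩
  tfae_have 4 ↔ 3 := by rw [hright]
  tfae_have 5 ↔ 3 := by rw [hboth]
  tfae_finish

end IsGDrazinInverse

end Compatible

section UpperCorner

variable {A : Type*} [NormedRing A] [NormedAlgebra ℂ A] [CompleteSpace A] {a b x y z : A}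

namespace IsGDrazinInverse

theorem summable_one_sub_mul_neg_pow (hb : IsGDrazinInverse b y) (x : A) :
    Summable fun n : ℕ => (1 - b * y) * (-b) ^ n * x ^ (n + 1) := by
  simpa only [neg_mul_neg, mul_assoc, ← pow_succ'] using
    hb.neg.summable_one_sub_mul_pow_mul x x

theorem mul_one_sub_eq_tsum (ha : IsGDrazinInverse a x) (hb : IsGDrazinInverse b y)
    (hab : IsGDrazinInverse (a + b) z) (h : Commute a b) :
    z * (1 - b * y) = ∑' n : ℕ, (1 - b * y) * (-b) ^ n * x ^ (n + 1) := by
  have he : IsIdempotentElem (1 - b * y) := hb.isIdempotentElem.one_sub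
  have hbe : Commute b (1 - b * y) := hb.commute_one_sub
  have hae : Commute a (1 - b * y) := (Commute.one_right a).sub_right
    (h.mul_right (hb.commute_of_commute h.symm).symm)
  have hxb : Commute x (-b) := (ha.commute_of_commute h).neg_right
  have hxe : Commute x (1 - b * y) := ha.commute_of_commute hae
  have hsum : IsGDrazinInverse ((a + b) * (1 - b * y))
      (∑' n : ℕ, (x * (1 - b * y)) ^ (n + 1) * (-(b * (1 - b * y))) ^ n) := by
    rw [add_comm a b, add_mul]
    refine (ha.mul_isIdempotentElem he hae).add_of_commute hb.isQuasinilpotent_mul_one_sub ?_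
    exact (h.symm.mul_right hbe).mul_left (hae.symm.mul_right (.refl _))
  rw [(hab.mul_isIdempotentElem he (hae.add_left hbe)).unique hsum]
  refine tsum_congr fun n => ?_
  have hpow : (1 - b * y) * (-b * (1 - b * y)) ^ n = (1 - b * y) * (-b) ^ n := by
    cases n with
    | zero => simp only [pow_zero]
    | succ n =>
      rw [hbe.neg_left.mul_pow, he.pow_succ_eq, (hbe.neg_left.pow_left _).eq, ← mul_assoc, he.eq]
  rw [hxe.mul_pow, he.pow_succ_eq, ← neg_mul, mul_assoc, hpow,
    ((hxe.mul_right (hxb.pow_right n)).pow_left (n + 1)).eq]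

theorem upper_add (ha : IsGDrazinInverse a x) (h : Commute a (a * x * b))
    (hz : IsGDrazinInverse (1 + x * b) z) : IsGDrazinInverse (a * x * (a + b)) (x * z) := by
  have hag := ha.commute_one_add_of_commute h
  have hpg := ha.commute_mul_of_commute hag
  have hpz : Commute z (a * x) := hz.commute_of_commute hpg.symm
  have hinv := ha.mul_of_commute (hz.mul_isIdempotentElem ha.isIdempotentElem hpg.symm)
    (hag.mul_right ha.commute_mul)
  rwa [← hpg.eq, ← ha.mul_mul_add_eq, hpz.eq, ← mul_assoc x, ha.mul_mul_self] at hinv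

theorem upper_add_eq (ha : IsGDrazinInverse a x) (hb : IsGDrazinInverse b y)
    (hbp : IsLowerTriangular (a * x) b) (hyp : IsLowerTriangular (a * x) y)
    (h : Commute a (a * x * b)) (hz : IsGDrazinInverse (1 + x * b) z) :
    x * z = x * z * b * y + a * x * ∑' n : ℕ, (1 - b * y) * (-b) ^ n * x ^ (n + 1) := by
  have hp := ha.isIdempotentElem
  have hpg := ha.commute_mul_of_commute (ha.commute_one_add_of_commute h)
  have hsplit : a * x * (a + b) = a * (a * x) + a * x * b := by
    rw [mul_add, ha.commute_mul.eq]
  have hc : IsGDrazinInverse (a * (a * x) + a * x * b) (x * z) := hsplit ▸ ha.upper_add h hz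
  have hcorner : x * z * (1 - a * x * b * (a * x * y)) = ∑' n : ℕ,
      (1 - a * x * b * (a * x * y)) * (-(a * x * b)) ^ n * (x * (a * x)) ^ (n + 1) :=
    (ha.mul_isIdempotentElem hp ha.commute_mul).mul_one_sub_eq_tsum (hb.upper hbp hyp) hc
      (h.mul_left (ha.commute_mul_of_commute h))
  have hzp : x * z * (a * x) = x * z := by
    rw [mul_assoc, (hz.commute_of_commute hpg.symm).eq, ← mul_assoc, ha.mul_mul_self]
  have hterm (n : ℕ) :
      (1 - a * x * b * (a * x * y)) * (-(a * x * b)) ^ n * (x * (a * x)) ^ (n + 1) =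
        a * x * ((1 - b * y) * (-b) ^ n * x ^ (n + 1)) := by
    have hby : (1 - a * x * b * (a * x * y)) * (a * x) = a * x * (1 - b * y) := by
      rw [hbp.upper_mul, one_sub_mul, (hbp.mul hyp).mul_mul_self, _root_.mul_one_sub]
    nth_rw 1 [ha.mul_mul_self, ← ha.mul_mul_pow_succ n]
    rw [← mul_assoc, ← mul_neg, mul_assoc _ _ (a * x), hbp.neg.upper_pow_mul, ← mul_assoc, hby]
    simp only [mul_assoc]
  rw [← (hb.summable_one_sub_mul_neg_pow x).tsum_mul_left, ← tsum_congr hterm, ← hcorner,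
    hbp.upper_mul, _root_.mul_one_sub, ← mul_assoc (x * z), hzp, ← mul_assoc (x * z),
    add_sub_cancel]

end IsGDrazinInverse

end UpperCorner

section BlockFormula

variable {A : Type*} [NormedRing A] [NormedAlgebra ℂ A] {a b p s w x z : A} {f : ℕ → A}

theorem IsLowerTriangular.one_sub_mul_lower_pow_mul (hw : IsLowerTriangular p w)
    (hp : IsIdempotentElem p) (hs : IsGDrazinInverse (w * (1 - p)) s) (n : ℕ) :
    (1 - w * (1 - p) * s) * (w * (1 - p)) ^ n * (1 - p) =
      w ^ n * (1 - p) - s * (w ^ (n + 1) * (1 - p)) := by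
  have hcomm : Commute (w * (1 - p)) (1 - p) := by
    rw [Commute, SemiconjBy, hw.one_sub_mul_mul, mul_assoc, hp.one_sub.eq]
  have hpow : (w * (1 - p)) ^ n * (1 - p) = w ^ n * (1 - p) := by
    rw [(hcomm.pow_left n).eq, hw.one_sub_mul_lower_pow]
  rw [← hw.lower_pow_succ, hs.comm, mul_assoc, sub_mul, one_mul, hpow, pow_succ', mul_assoc s,
    ← hpow, ← mul_assoc (w * (1 - p)), ← pow_succ', pow_succ, mul_assoc, hcomm.eq,
    hw.one_sub_mul_mul, ← pow_succ]

namespace IsGDrazinInverse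

theorem coupling_add_left_term (ha : IsGDrazinInverse a x) (hbp : IsLowerTriangular (a * x) b)
    (hz : IsGDrazinInverse (a * x * (a + b)) z) (hf : Summable f)
    (hs : IsGDrazinInverse ((a + b) * (1 - a * x)) (∑' k, f k)) (n : ℕ) :
    (1 - (a + b) * (1 - a * x) * ∑' k, f k) * ((a + b) * (1 - a * x)) ^ n *
        ((1 - a * x) * b * (a * x)) * z ^ (n + 2) =
      (a + b) ^ n * (1 - a * x) * b * z ^ (n + 2) -
        ∑' k, f k * (a + b) ^ (n + 1) * (1 - a * x) * b * z ^ (n + 2) := by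
  have hp := ha.isIdempotentElem
  have hblock := (ha.isLowerTriangular.add hbp).one_sub_mul_lower_pow_mul hp hs n
  calc _ = (1 - (a + b) * (1 - a * x) * ∑' k, f k) * ((a + b) * (1 - a * x)) ^ n * (1 - a * x) *
        (b * (a * x * z * z ^ (n + 1))) := by simp only [pow_succ' z (n + 1), mul_assoc]
    _ = _ := by
      rw [hblock, idempotent_mul_eq hp hz, ← pow_succ', sub_mul]
      simp only [mul_assoc, hf.tsum_mul_right]

theorem coupling_add_right_term (hp : IsIdempotentElem (a * x))
    (hs : IsGDrazinInverse (w * (1 - a * x)) s) (u : A) (n : ℕ) :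
    s ^ (n + 2) * ((1 - a * x) * b * (a * x)) * u = s ^ (n + 2) * b * a * x * u := by
  rw [pow_succ, mul_assoc _ b, ← mul_assoc _ (1 - a * x), mul_assoc _ s,
    mul_idempotent_eq hp.one_sub hs]
  simp only [mul_assoc]

variable [CompleteSpace A]

theorem summable_add_left_term (ha : IsGDrazinInverse a x) (hbp : IsLowerTriangular (a * x) b)
    (hz : IsGDrazinInverse (a * x * (a + b)) z) (hf : Summable f)
    (hs : IsGDrazinInverse ((a + b) * (1 - a * x)) (∑' k, f k)) :
    Summable fun n : ℕ => (a + b) ^ n * (1 - a * x) * b * z ^ (n + 2) -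
      ∑' k, f k * (a + b) ^ (n + 1) * (1 - a * x) * b * z ^ (n + 2) :=
  (hs.summable_coupling_left _ z 2).congr fun n =>
    ha.coupling_add_left_term hbp hz hf hs n

theorem summable_add_right_term (hz : IsGDrazinInverse w z) (s b a x : A) :
    Summable fun n : ℕ => s ^ (n + 2) * b * a * x * w ^ n * (1 - w * z) := by
  simpa only [mul_assoc] using hz.summable_coupling_right s (b * (a * x)) 2

theorem add_of_corners (ha : IsGDrazinInverse a x) (hbp : IsLowerTriangular (a * x) b)
    (hz : IsGDrazinInverse (a * x * (a + b)) z) (hf : Summable f)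
    (hs : IsGDrazinInverse ((a + b) * (1 - a * x)) (∑' k, f k)) :
    IsGDrazinInverse (a + b) (z + (∑' n, f n) - (∑' n, f n * b * z) +
      (∑' n : ℕ, (∑' k, f k) ^ (n + 2) * b * a * x * (a * x * (a + b)) ^ n *
        (1 - a * x * (a + b) * z)) +
      ∑' n : ℕ, ((a + b) ^ n * (1 - a * x) * b * z ^ (n + 2) -
        ∑' k, f k * (a + b) ^ (n + 1) * (1 - a * x) * b * z ^ (n + 2))) := by
  have hp := ha.isIdempotentElem
  have hoff : (1 - a * x) * (a + b) * (a * x) = (1 - a * x) * b * (a * x) := by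
    rw [mul_add, add_mul, ← ha.commute_one_sub.eq, mul_assoc a, hp.one_sub_mul_self, mul_zero,
      zero_add]
  have h := of_corners hp (ha.isLowerTriangular.add hbp) hz hs
  have hsbz : (∑' k, f k) * ((1 - a * x) * b * (a * x)) * z = ∑' k, f k * b * z := by
    rw [(hf.mul_right b).tsum_mul_right, hf.tsum_mul_right, mul_assoc _ b, ← mul_assoc,
      mul_idempotent_eq hp.one_sub hs, mul_assoc, mul_assoc b, idempotent_mul_eq hp hz,
      ← mul_assoc]
  rw [hoff, gDrazinCoupling, hsbz, tsum_congr (ha.coupling_add_left_term hbp hz hf hs)] at h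
  simp only [coupling_add_right_term hp hs] at h
  convert h using 1
  abel

end IsGDrazinInverse

end BlockFormula

theorem corollary2p5 {A : Type*} [NormedRing A] [NormedAlgebra ℂ A] [CompleteSpace A]
    (a b : A) (ha : IsGDrazinInvertible a) (hb : IsGDrazinInvertible b)
    (hab : a * b * specIdem a = specIdem a * b * a * specIdem a)
    (hcomm : a ^ 2 * aᵈ * b = a * aᵈ * b * a)
    (hcorner : IsGDrazinInvertible (specIdem a * b * specIdem a) ∨
      IsGDrazinInvertible (specIdem a * b) ∨
      IsGDrazinInvertible (b * specIdem a) ∨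
      IsGDrazinInvertible (a * aᵈ * b * a * aᵈ) ∨
      IsGDrazinInvertible (a * aᵈ * b) ∨
      IsGDrazinInvertible (b * a * aᵈ)) :
    List.TFAE [
      IsGDrazinInvertible (a + b),
      IsGDrazinInvertible (1 + aᵈ * b),
      IsGDrazinInvertible (a * aᵈ * (1 + aᵈ * b)),
      IsGDrazinInvertible ((1 + aᵈ * b) * a * aᵈ),
      IsGDrazinInvertible (a * aᵈ * (1 + aᵈ * b) * a * aᵈ)] ∧
    (IsGDrazinInvertible (a + b) → ∀ c : A, c = a * aᵈ * (a + b) →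
      -- the element `c` and its generalized Drazin inverse
      IsGDrazinInvertible c ∧
      Summable (fun n : ℕ => specIdem b * (-b) ^ n * aᵈ ^ (n + 1)) ∧
      cᵈ = aᵈ * (1 + aᵈ * b)ᵈ * b * bᵈ +
        a * aᵈ * ∑' n : ℕ, specIdem b * (-b) ^ n * aᵈ ^ (n + 1) ∧
      -- convergence of the series in the formula for the inverse of `a + b`
      Summable (fun n : ℕ => bᵈ ^ (n + 1) * (-a) ^ n * specIdem a) ∧
      Summable (fun n : ℕ => bᵈ ^ (n + 1) * (-a) ^ n * specIdem a * b * cᵈ) ∧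
      Summable (fun n : ℕ =>
        (∑' k : ℕ, bᵈ ^ (k + 1) * (-a) ^ k * specIdem a) ^ (n + 2) *
          b * a * aᵈ * c ^ n * specIdem c) ∧
      (∀ n : ℕ, Summable (fun k : ℕ => bᵈ ^ (k + 1) * (-a) ^ k * specIdem a *
          (a + b) ^ (n + 1) * specIdem a * b * cᵈ ^ (n + 2))) ∧
      Summable (fun n : ℕ =>
        (a + b) ^ n * specIdem a * b * cᵈ ^ (n + 2) -
          ∑' k : ℕ, bᵈ ^ (k + 1) * (-a) ^ k * specIdem a *
            (a + b) ^ (n + 1) * specIdem a * b * cᵈ ^ (n + 2)) ∧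
      -- the formula itself
      (a + b)ᵈ = cᵈ
        + (∑' n : ℕ, bᵈ ^ (n + 1) * (-a) ^ n * specIdem a)
        - (∑' n : ℕ, bᵈ ^ (n + 1) * (-a) ^ n * specIdem a * b * cᵈ)
        + (∑' n : ℕ, (∑' k : ℕ, bᵈ ^ (k + 1) * (-a) ^ k * specIdem a) ^ (n + 2) *
            b * a * aᵈ * c ^ n * specIdem c)
        + (∑' n : ℕ, ((a + b) ^ n * specIdem a * b * cᵈ ^ (n + 2) -
            ∑' k : ℕ, bᵈ ^ (k + 1) * (-a) ^ k * specIdem a *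
              (a + b) ^ (n + 1) * specIdem a * b * cᵈ ^ (n + 2)))) := by
  unfold specIdem at *
  have hA := ha.isGDrazinInverse
  have hB := hb.isGDrazinInverse
  have hp := hA.isIdempotentElem
  have hbp := hA.isLowerTriangular_of_compatible hab
  have hap : Commute a (a * aᵈ * b) := by
    rw [Commute, SemiconjBy, ← hcomm, sq]
    simp only [mul_assoc]
  have hyp : IsLowerTriangular (a * aᵈ) bᵈ := hB.isLowerTriangular_of_corner hp hbp
    (by simpa only [mul_assoc] using hcorner)
  have hlower := hA.lower_add hB hbp hyp (hA.commute_of_compatible hab)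
  have htfae := hA.tfae_add hbp hap ⟨_, hlower⟩
  refine ⟨htfae, fun hw c hc => ?_⟩
  obtain ⟨z, hz⟩ := (htfae.out 0 1).1 hw
  have hcz := hA.upper_add hap hz
  have hf := hA.summable_mul_neg_pow_mul_one_sub bᵈ
  subst hc
  rw [hz.gDrazinInv_eq, hcz.gDrazinInv_eq]
  exact ⟨⟨_, hcz⟩, hB.summable_one_sub_mul_neg_pow _, hA.upper_add_eq hB hbp hyp hap hz, hf,
    (hf.mul_right _).mul_right _, hcz.summable_add_right_term _ b a aᵈ,
    fun n => (((hf.mul_right _).mul_right _).mul_right _).mul_right _,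
    hA.summable_add_left_term hbp hcz hf hlower,
    (hA.add_of_corners hbp hcz hf hlower).gDrazinInv_eq⟩
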